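/- Let $X$ and $Y$ be complex Banach spaces, and let $A\in\mathcal B(X)$, $B\in\mathcal B(Y)$, $C\in\mathcal B(Y,X)$, where $\mathcal B(\cdot)$ denotes bounded linear operators. A bounded operator $T$ is called Fredholm if its kernel is finite-dimensional and its range is closed and of finite codimension; it is called Riesz if $T-\lambda I$ is Fredholm for every $\lambda\in\mathbb C\setminus\{0\}$. A bounded operator $S$ is called a generalized Drazin–Riesz inverse of $T$ if $TS=ST$, $STS=S$ and $T-TST$ is Riesz; $T$ is called generalized Drazin–Riesz invertible if such an $S$ exists. Let $$M_C=\begin{pmatrix}A & C\\ 0 & B\end{pmatrix}\in\mathcal B(X\oplus Y).$$ Suppose that $M_C$ has a generalized Drazin–Riesz inverse of the form $$S=\begin{pmatrix}U & W\\ 0 & V\end{pmatrix},\qquad U\in\mathcal B(X),\ V\in\mathcal B(Y),\ W\in\mathcal B(Y,X).$$ Then $A$ and $B$ are generalized Drazin–Riesz invertible; more precisely, $U$ is a generalized Drazin–Riesz inverse of $A$ and $V$ is a generalized Drazin–Riesz inverse of $B$. -/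

import Mathlib

namespace GenDrazinRiesz

variable {X Y : Type*} [NormedAddCommGroup X] [NormedSpace ℂ X]
  [NormedAddCommGroup Y] [NormedSpace ℂ Y]

/-- A bounded operator `T` is a Riesz operator if `T - λ I` is Fredholm for every nonzero
complex number `λ`. -/
def IsRiesz (T : X →L[ℂ] X) : Prop :=
  ∀ z : ℂ, z ≠ 0 → (T - z • ContinuousLinearMap.id ℂ X).IsFredholm

/-- `S` is a generalized Drazin-Riesz inverse of `T`:
`TS = ST`, `STS = S`, and `T - TST` is Riesz. -/
structure IsGDRInverse (T S : X →L[ℂ] X) : Prop where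
  comm : T ∘L S = S ∘L T
  inner : S ∘L T ∘L S = S
  riesz : IsRiesz (T - T ∘L S ∘L T)

/-- `T` is generalized Drazin-Riesz invertible. -/
def IsGDRInvertible (T : X →L[ℂ] X) : Prop :=
  ∃ S : X →L[ℂ] X, IsGDRInverse T S

/-- The bounded operator on `X ⊕ Y` with upper triangular matrix `(A C; 0 B)`, that is
`(x, y) ↦ (A x + C y, B y)`. -/
def upperTri (A : X →L[ℂ] X) (C : Y →L[ℂ] X) (B : Y →L[ℂ] Y) : (X × Y) →L[ℂ] (X × Y) :=
  (A.coprod C).prod (B ∘L ContinuousLinearMap.snd ℂ X Y)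

theorem upperTri_apply (A : X →L[ℂ] X) (C : Y →L[ℂ] X) (B : Y →L[ℂ] Y) (x : X) (y : Y) :
    upperTri A C B (x, y) = (A x + C y, B y) := rfl

end GenDrazinRiesz

/-!
Multiplying out the block matrices shows that `U` and `V` satisfy the two algebraic identities of a
generalized Drazin-Riesz inverse, and that `M - MSM`, where `M` is the given block operator, is
again upper triangular, with diagonal entries `A - AUA` and `B - BVB`. What remains is that the
diagonal entries of an upper triangular Riesz operator `N` are Riesz
(`IsRiesz.of_upperTri_left`, `IsRiesz.of_upperTri_right`).

For `z ≠ 0` the operator `N - z` is invertible modulo finite rank operators, and compressing its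
quasi-inverse to the two summands shows that the first diagonal entry `T₁` of `N` has `T₁ - z`
left invertible, and the second one `T₂` has `T₂ - z` right invertible, modulo finite rank
operators. A one-sided inverse at every `z ≠ 0` is in fact two-sided
(`isUnit_map_sub_smul_one_of_one_sided`): if `c (T - z) = 1` in the quotient ring, then
`c (T - w)` is invertible there for all `w` close to `z`, so that for such `w` the class of `T - w`
is a unit if and only if the class of `c` is. Hence being a unit is a locally constant property of
`w` on the connected set `ℂ \ {0}`, and it holds when `|w|` is large. No index theory is needed.
-/

namespace GenDrazinRiesz

open Filter Topology LinearMap.FiniteRangeSetoid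

/-! ### One-sided invertibility in a quotient of a Banach algebra -/

section Quotient

variable {R Q : Type*} [NormedRing R] [CompleteSpace R] [Ring Q]

/-- If `f z` is mapped to one, then `f w` is mapped to a unit for `w` close to `z`. No topology on
`Q` is involved: `f w` has the same image as `1 + (f w - f z)`, which is a unit of `R`. -/
theorem eventually_isUnit_map_of_map_eq_one (φ : R →+* Q) {f : ℂ → R} {z : ℂ}
    (hf : ContinuousAt f z) (hz : φ (f z) = 1) : ∀ᶠ w in 𝓝 z, IsUnit (φ (f w)) := by
  have hg : ContinuousAt (fun w ↦ 1 + (f w - f z)) z :=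
    continuousAt_const.add (hf.sub continuousAt_const)
  have hu : {x : R | IsUnit x} ∈ 𝓝 (1 + (f z - f z)) :=
    Units.isOpen.mem_nhds (by simp)
  filter_upwards [hg.preimage_mem_nhds hu] with w hw
  have hw' : IsUnit (φ (1 + (f w - f z))) := IsUnit.map φ hw
  simpa [hz] using hw'

/-- If the image of `T - z` has a left or a right inverse for every `z ≠ 0`, then it is a unit for
every `z ≠ 0`. -/
theorem isUnit_map_sub_smul_one_of_one_sided [NormedAlgebra ℂ R] (φ : R →+* Q) (T : R)
    (h : ∀ z : ℂ, z ≠ 0 →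
      ∃ c, φ (c * (T - z • 1)) = 1 ∨ φ ((T - z • 1) * c) = 1)
    {z : ℂ} (hz : z ≠ 0) : IsUnit (φ (T - z • 1)) := by
  have hconn : IsPreconnected ({0}ᶜ : Set ℂ) :=
    (isConnected_compl_singleton_of_one_lt_rank (by simp) 0).isPreconnected
  -- Beyond `‖T‖ * ‖1‖` the element `T - w` is already invertible in `R`.
  obtain ⟨w, hw0, hw⟩ : ∃ w : ℂ, w ≠ 0 ∧ IsUnit (φ (T - w • 1)) := by
    have hpos : (0 : ℝ) < ‖T‖ * ‖(1 : R)‖ + 1 := by positivity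
    refine ⟨((‖T‖ * ‖(1 : R)‖ + 1 : ℝ) : ℂ), by exact_mod_cast hpos.ne', IsUnit.map φ ?_⟩
    have hres := spectrum.mem_resolventSet_of_norm_lt_mul (𝕜 := ℂ) (a := T)
      (k := ((‖T‖ * ‖(1 : R)‖ + 1 : ℝ) : ℂ))
      (by rw [Complex.norm_real, Real.norm_of_nonneg hpos.le]; linarith)
    rw [spectrum.mem_resolventSet_iff, Algebra.algebraMap_eq_smul_one] at hres
    rw [← neg_sub]
    exact hres.neg
  refine (hconn.induction₂
    (fun x y ↦ IsUnit (φ (T - x • 1)) ↔ IsUnit (φ (T - y • 1))) ?_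
    (fun _ _ _ _ _ _ hxy hyz ↦ hxy.trans hyz) (fun _ _ _ _ hxy ↦ hxy.symm)
    (x := w) (y := z) hw0 hz).mp hw
  intro x hx
  obtain ⟨c, hc | hc⟩ := h x hx
  · have key : ∀ᶠ y in 𝓝 x, IsUnit (φ c) ↔ IsUnit (φ (T - y • 1)) := by
      filter_upwards [eventually_isUnit_map_of_map_eq_one φ
        (f := fun y : ℂ ↦ c * (T - y • 1)) (by fun_prop) hc] with y hy
      rw [map_mul] at hy
      constructor
      · rintro ⟨u, hu⟩
        rwa [← hu, Units.isUnit_units_mul] at hy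
      · rintro ⟨u, hu⟩
        rwa [← hu, Units.isUnit_mul_units] at hy
    filter_upwards [nhdsWithin_le_nhds key] with y hy
    exact key.self_of_nhds.symm.trans hy
  · have key : ∀ᶠ y in 𝓝 x, IsUnit (φ c) ↔ IsUnit (φ (T - y • 1)) := by
      filter_upwards [eventually_isUnit_map_of_map_eq_one φ
        (f := fun y : ℂ ↦ (T - y • 1) * c) (by fun_prop) hc] with y hy
      rw [map_mul] at hy
      constructor
      · rintro ⟨u, hu⟩
        rwa [← hu, Units.isUnit_mul_units] at hy
      · rintro ⟨u, hu⟩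
        rwa [← hu, Units.isUnit_units_mul] at hy
    filter_upwards [nhdsWithin_le_nhds key] with y hy
    exact key.self_of_nhds.symm.trans hy

end Quotient

/-! ### Bounded operators modulo finite rank -/

section FiniteRank

variable {X : Type*} [NormedAddCommGroup X] [NormedSpace ℂ X]

variable (X) in
/-- The congruence on the ring of bounded operators on `X` identifying operators whose difference
has finite rank. -/
def finiteRankCon : RingCon (X →L[ℂ] X) where
  r S T := (S : X →ₗ[ℂ] X) ≈ (T : X →ₗ[ℂ] X)
  iseqv := ⟨fun _ ↦ Setoid.refl _, fun h ↦ Setoid.symm h, fun h k ↦ Setoid.trans h k⟩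
  mul' h k := equiv_comp k h
  add' {a b c d} h k := by
    rw [equiv_iff_hasFiniteRange] at *
    simpa [add_sub_add_comm] using h.add k

/-- The quotient map from the bounded operators on `X` to their classes modulo finite rank. -/
def modFiniteRank : (X →L[ℂ] X) →+* (finiteRankCon X).Quotient :=
  (finiteRankCon X).mk'

theorem modFiniteRank_eq_iff {S T : X →L[ℂ] X} :
    modFiniteRank S = modFiniteRank T ↔ (S : X →ₗ[ℂ] X) ≈ (T : X →ₗ[ℂ] X) :=
  (finiteRankCon X).eq

theorem modFiniteRank_eq_one_iff {T : X →L[ℂ] X} :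
    modFiniteRank T = 1 ↔ (T : X →ₗ[ℂ] X) ≈ LinearMap.id := by
  rw [← map_one modFiniteRank, modFiniteRank_eq_iff]
  rfl

theorem isFredholm_of_isUnit_modFiniteRank {T : X →L[ℂ] X} (h : IsUnit (modFiniteRank T)) :
    T.IsFredholm := by
  obtain ⟨q, hTq, hqT⟩ := isUnit_iff_exists.mp h
  obtain ⟨S, rfl⟩ := (finiteRankCon X).mk'_surjective q
  change modFiniteRank T * modFiniteRank S = 1 at hTq
  change modFiniteRank S * modFiniteRank T = 1 at hqT
  rw [← map_mul, modFiniteRank_eq_one_iff] at hTq hqT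
  exact .of_isQuasiInverse (v := S) ⟨hqT, hTq⟩

/-- An operator is Riesz as soon as all its translates by nonzero scalars have a one-sided inverse
modulo finite rank. -/
theorem IsRiesz.of_one_sided [CompleteSpace X] {T : X →L[ℂ] X}
    (h : ∀ z : ℂ, z ≠ 0 → ∃ c : X →L[ℂ] X,
      modFiniteRank (c * (T - z • 1)) = 1 ∨ modFiniteRank ((T - z • 1) * c) = 1) :
    IsRiesz T := fun _ hz ↦
  isFredholm_of_isUnit_modFiniteRank (isUnit_map_sub_smul_one_of_one_sided modFiniteRank T h hz)

end FiniteRank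

/-! ### Upper triangular operators -/

section UpperTri

variable {X Y : Type*} [NormedAddCommGroup X] [NormedSpace ℂ X]
  [NormedAddCommGroup Y] [NormedSpace ℂ Y]

theorem upperTri_comp (A A' : X →L[ℂ] X) (C C' : Y →L[ℂ] X) (B B' : Y →L[ℂ] Y) :
    upperTri A C B ∘L upperTri A' C' B' =
      upperTri (A ∘L A') (A ∘L C' + C ∘L B') (B ∘L B') := by
  refine ContinuousLinearMap.ext fun p ↦ ?_
  simp [upperTri, add_assoc]

theorem upperTri_sub (A A' : X →L[ℂ] X) (C C' : Y →L[ℂ] X) (B B' : Y →L[ℂ] Y) :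
    upperTri A C B - upperTri A' C' B' = upperTri (A - A') (C - C') (B - B') := by
  refine ContinuousLinearMap.ext fun p ↦ ?_
  simp [upperTri, add_sub_add_comm]

theorem upperTri_sub_smul_id (A : X →L[ℂ] X) (C : Y →L[ℂ] X) (B : Y →L[ℂ] Y) (z : ℂ) :
    upperTri A C B - z • ContinuousLinearMap.id ℂ (X × Y) =
      upperTri (A - z • 1) C (B - z • 1) := by
  refine ContinuousLinearMap.ext fun p ↦ ?_
  ext <;> simp [upperTri, sub_add_eq_add_sub]

theorem upperTri_inj {A A' : X →L[ℂ] X} {C C' : Y →L[ℂ] X} {B B' : Y →L[ℂ] Y}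
    (h : upperTri A C B = upperTri A' C' B') : A = A' ∧ B = B' := by
  constructor
  · ext x
    simpa [upperTri] using congr(($h (x, 0)).1)
  · ext y
    simpa [upperTri] using congr(($h (0, y)).2)

/-- The upper left corner of a left quasi-inverse of an upper triangular operator is a left
quasi-inverse of the upper left entry. -/
theorem exists_left_inverse_modFiniteRank_of_upperTri {A : X →L[ℂ] X} {C : Y →L[ℂ] X}
    {B : Y →L[ℂ] Y} (h : (upperTri A C B).IsFredholm) :
    ∃ P : X →L[ℂ] X, modFiniteRank (P * A) = 1 := by
  obtain ⟨v, hv, -⟩ := h.exists_isQuasiInverse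
  refine ⟨.fst ℂ X Y ∘L v ∘L .inl ℂ X Y, modFiniteRank_eq_one_iff.mpr ?_⟩
  have key := equiv_comp_left (u' := LinearMap.fst ℂ X Y)
    (equiv_comp_right (u := LinearMap.inl ℂ X Y) hv.equiv)
  convert key using 1
  · ext x
    simp [upperTri]
  · rfl

/-- The lower right corner of a right quasi-inverse of an upper triangular operator is a right
quasi-inverse of the lower right entry. -/
theorem exists_right_inverse_modFiniteRank_of_upperTri {A : X →L[ℂ] X} {C : Y →L[ℂ] X}
    {B : Y →L[ℂ] Y} (h : (upperTri A C B).IsFredholm) :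
    ∃ P : Y →L[ℂ] Y, modFiniteRank (B * P) = 1 := by
  obtain ⟨v, -, hv⟩ := h.exists_isQuasiInverse
  refine ⟨.snd ℂ X Y ∘L v ∘L .inr ℂ X Y, modFiniteRank_eq_one_iff.mpr ?_⟩
  have key := equiv_comp_left (u' := LinearMap.snd ℂ X Y)
    (equiv_comp_right (u := LinearMap.inr ℂ X Y) hv.equiv)
  convert key using 1
  · ext x
    simp [upperTri]
  · rfl

theorem IsRiesz.of_upperTri_left [CompleteSpace X] {A : X →L[ℂ] X} {C : Y →L[ℂ] X}
    {B : Y →L[ℂ] Y} (h : IsRiesz (upperTri A C B)) : IsRiesz A :=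
  .of_one_sided fun z hz ↦
    (exists_left_inverse_modFiniteRank_of_upperTri (upperTri_sub_smul_id A C B z ▸ h z hz)).imp
      fun _ ↦ Or.inl

theorem IsRiesz.of_upperTri_right [CompleteSpace Y] {A : X →L[ℂ] X} {C : Y →L[ℂ] X}
    {B : Y →L[ℂ] Y} (h : IsRiesz (upperTri A C B)) : IsRiesz B :=
  .of_one_sided fun z hz ↦
    (exists_right_inverse_modFiniteRank_of_upperTri (upperTri_sub_smul_id A C B z ▸ h z hz)).imp
      fun _ ↦ Or.inr

end UpperTri

end GenDrazinRiesz

open GenDrazinRiesz in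
theorem mainTheorem8 {X Y : Type*}
    [NormedAddCommGroup X] [NormedSpace ℂ X] [CompleteSpace X]
    [NormedAddCommGroup Y] [NormedSpace ℂ Y] [CompleteSpace Y]
    (A : X →L[ℂ] X) (B : Y →L[ℂ] Y) (C : Y →L[ℂ] X)
    (U : X →L[ℂ] X) (V : Y →L[ℂ] Y) (W : Y →L[ℂ] X)
    (hS : GenDrazinRiesz.IsGDRInverse
      (GenDrazinRiesz.upperTri A C B) (GenDrazinRiesz.upperTri U W V)) :
    (GenDrazinRiesz.IsGDRInvertible A ∧ GenDrazinRiesz.IsGDRInverse A U) ∧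
      (GenDrazinRiesz.IsGDRInvertible B ∧ GenDrazinRiesz.IsGDRInverse B V) := by
  obtain ⟨hcomm, hinner, hriesz⟩ := hS
  simp only [upperTri_comp, upperTri_sub] at hcomm hinner hriesz
  have hA : IsGDRInverse A U :=
    ⟨(upperTri_inj hcomm).1, (upperTri_inj hinner).1, hriesz.of_upperTri_left⟩
  have hB : IsGDRInverse B V :=
    ⟨(upperTri_inj hcomm).2, (upperTri_inj hinner).2, hriesz.of_upperTri_right⟩
  exact ⟨⟨⟨U, hA⟩, hA⟩, ⟨⟨V, hB⟩, hB⟩⟩
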